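/- A hemiring is a set with a commutative addition with neutral element $0$ and an associative multiplication (possibly without identity) that distributes over addition on both sides and satisfies $0r=0=r0$ for all $r$. A left semimodule over a hemiring $R$ is a commutative monoid $M$ with an action of $R$ satisfying $(rs)m=r(sm)$, $r(m+n)=rm+rn$, $(r+s)m=rm+sm$ and $r0_M=0_M=0m$; it is simple if $RM\neq 0$, its only subsemimodules are $0$ and $M$, and its only congruences are the diagonal and the universal one. Let $J_s(R)$ be the intersection of the annihilators $(0:M)_R=\{r\in R \mid rM=0\}$ of all simple left $R$-semimodules $M$ (so $J_s(R)=R$ if there are none). A semiisomorphism is a surjective homomorphism of hemirings $f$ with $f^{-1}(0)=\{0\}$. A subdirect product of hemirings $S_i$ $(i\in I)$ is a subhemiring of $\prod_{i\in I}S_i$ that every projection maps onto the factor $S_i$. A semilattice with zero is a join semilattice $M$ with a least element $0$, i.e. a commutative monoid with $x+x=x$ for all $x$ (where $x+y=x\vee y$), and $\mathrm{End}(M)$ is the hemiring of its endomorphisms (preserving joins and $0$) under pointwise addition and composition. A subhemiring of $\mathrm{End}(M)$ is dense if it contains all the endomorphisms $e_{a,b}$ $(a,b\in M)$, where $e_{a,b}(x)=0$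 if $x\le a$ and $e_{a,b}(x)=b$ otherwise; equivalently, if it contains the additive submonoid generated by them. Theorem. Let $R$ be a finite additively idempotent hemiring ($r+r=r$ for all $r\in R$). Then $J_s(R)=0$ if and only if there is a semiisomorphism from $R$ onto a subdirect product of some hemirings $S_i$ $(i\in I)$ such that each $S_i$ is isomorphic to a dense subhemiring of $\mathrm{End}(M_i)$ for some finite semilattice $M_i$ with zero. -/

import Mathlib

universe u

/- 
A hemiring is an additively commutative monoid with an associative, distributive multiplication
for which `0` is absorbing and which need not have an identity: Mathlib's `NonUnitalSemiring`.
Hemiring homomorphisms are `R →ₙ+* S` and subhemirings are `NonUnitalSubsemiring R`.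
-/

/-- A left semimodule over a (not necessarily unital) hemiring. -/
class LeftSemimodule (R M : Type*) [NonUnitalSemiring R] [AddCommMonoid M] extends SMul R M where
  mul_smul : ∀ (r s : R) (m : M), (r * s) • m = r • (s • m)
  smul_add : ∀ (r : R) (m n : M), r • (m + n) = r • m + r • n
  add_smul : ∀ (r s : R) (m : M), (r + s) • m = r • m + s • m
  smul_zero : ∀ r : R, r • (0 : M) = 0
  zero_smul : ∀ m : M, (0 : R) • m = 0

/-- A simple left semimodule: `RM ≠ 0`, the only subsemimodules are `0` and `M`, and the only
congruences are the diagonal and the universal one. -/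
structure IsSimpleLeftSemimodule (R M : Type*) [NonUnitalSemiring R] [AddCommMonoid M]
    [LeftSemimodule R M] : Prop where
  exists_smul_ne_zero : ∃ (r : R) (m : M), r • m ≠ 0
  subsemimodule_trivial : ∀ N : AddSubmonoid M, (∀ (r : R), ∀ m ∈ N, r • m ∈ N) → N = ⊥ ∨ N = ⊤
  congruence_trivial : ∀ c : ModuleCon R M, (∀ x y : M, c.r x y → x = y) ∨ (∀ x y : M, c.r x y)

/-- The annihilator `(0 : M)_R` of a left semimodule. -/
def leftAnnihilator (R M : Type*) [NonUnitalSemiring R] [AddCommMonoid M]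
    [LeftSemimodule R M] : Set R :=
  {r | ∀ m : M, r • m = 0}

/-- The radical `J_s(R)`: the intersection of the annihilators of all simple left `R`-semimodules.
(A simple semimodule is generated by the elements `r • m` for any one of its nonzero elements
`m`, so that it is never larger than `R`, and nothing is lost by keeping to the universe of `R`.) -/
def radicalJs (R : Type u) [NonUnitalSemiring R] : Set R :=
  {r | ∀ (M : Type u) [AddCommMonoid M] [LeftSemimodule R M],
    IsSimpleLeftSemimodule R M → r ∈ leftAnnihilator R M}

/-- A `J_s`-semisimple hemiring: `J_s(R) = 0`. -/
def IsJsSemisimple (R : Type u) [NonUnitalSemiring R] : Prop :=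
  radicalJs R = {0}

/-- A semiisomorphism of hemirings: a surjective homomorphism with zero kernel
(which need not be injective). -/
def IsSemiisomorphism {R S : Type*} [NonUnitalSemiring R] [NonUnitalSemiring S]
    (f : R →ₙ+* S) : Prop :=
  Function.Surjective f ∧ ∀ r : R, f r = 0 → r = 0

/-- A subhemiring `T` of the direct product of the `S i` is a subdirect product of the `S i`
if all the projections map it onto the factors. -/
def IsSubdirectProduct {I : Type*} {S : I → Type*} [∀ i, NonUnitalSemiring (S i)]
    (T : NonUnitalSubsemiring (∀ i, S i)) : Prop :=
  ∀ i, Function.Surjective (fun t : T => (t : ∀ i, S i) i)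

/-- A (join) semilattice with zero, written additively: a commutative monoid in which every
element is idempotent. The join of `a` and `b` is `a + b`, the least element is `0`, and `x ≤ a`
means `x + a = a`. Its endomorphism hemiring is Mathlib's `AddMonoid.End M`, with pointwise
addition and with composition as multiplication. -/
class SemilatticeWithZero (M : Type*) extends AddCommMonoid M where
  add_self : ∀ x : M, x + x = x

namespace SemilatticeWithZero

variable {M : Type*} [SemilatticeWithZero M]

/-- The order `x ≤ y` of the semilattice. -/
def Below (x y : M) : Prop := x + y = y

theorem below_zero (a : M) : Below 0 a := zero_add a

theorem add_below_iff (x y a : M) : Below (x + y) a ↔ Below x a ∧ Below y a := by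
  unfold Below
  constructor
  · intro h
    constructor
    · calc x + a = x + (x + y + a) := by rw [h]
        _ = (x + x) + y + a := by simp only [add_assoc]
        _ = a := by rw [add_self, h]
    · calc y + a = y + (x + y + a) := by rw [h]
        _ = x + (y + y) + a := by rw [← add_assoc, ← add_assoc, add_comm y x, add_assoc x y y]
        _ = a := by rw [add_self, h]
  · rintro ⟨hx, hy⟩
    rw [add_assoc, hy, hx]

open Classical in
/-- The endomorphism `e_{a,b}`, with `e_{a,b}(x) = 0` if `x ≤ a` and `e_{a,b}(x) = b` otherwise. -/
noncomputable def e (a b : M) : AddMonoid.End M where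
  toFun x := if Below x a then 0 else b
  map_zero' := if_pos (below_zero a)
  map_add' x y := by
    by_cases hx : Below x a <;> by_cases hy : Below y a <;>
      simp [add_below_iff, hx, hy, add_self]

variable (M) in
/-- `F_M`: the submonoid of `(End(M), +, 0)` generated by all the `e_{a,b}`. -/
noncomputable def F : AddSubmonoid (AddMonoid.End M) :=
  AddSubmonoid.closure {f | ∃ a b : M, f = e a b}

/-- A subhemiring of `End(M)` is dense if it contains `F_M`. -/
def IsDenseSubhemiring (D : NonUnitalSubsemiring (AddMonoid.End M)) : Prop :=
  ∀ f ∈ F M, f ∈ D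

end SemilatticeWithZero

/-! Simple semimodules and dense actions on nonzero finite semilattices are the same thing here. A
simple module is `R • x` for any `x ≠ 0`, so it inherits finiteness and idempotence from `R`, and
its points are separated by their annihilators; summing suitable elements of `R` then yields every
`e a b` (`isDenseSubhemiring_srange`). Conversely, the maps `e a b` suffice to rule out proper
subsemimodules and congruences (`isSimpleLeftSemimodule_ofEnd`). The radical therefore vanishes iff
each `r ≠ 0` acts nontrivially in some dense action, and the product of such actions is a map with
zero kernel. -/

namespace LeftSemimodule

variable {R M : Type*} [NonUnitalSemiring R] [AddCommMonoid M]

/-- The action of a hemiring on a semimodule, as a homomorphism to the endomorphism hemiring. -/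
def toEnd (R M : Type*) [NonUnitalSemiring R] [AddCommMonoid M] [LeftSemimodule R M] :
    R →ₙ+* AddMonoid.End M where
  toFun r :=
    { toFun := fun m => r • m
      map_zero' := LeftSemimodule.smul_zero r
      map_add' := LeftSemimodule.smul_add r }
  map_mul' r s := by ext m; exact LeftSemimodule.mul_smul r s m
  map_zero' := by ext m; exact LeftSemimodule.zero_smul m
  map_add' r s := by ext m; exact LeftSemimodule.add_smul r s m

@[simp]
theorem toEnd_apply [LeftSemimodule R M] (r : R) (m : M) : toEnd R M r m = r • m := rfl

/-- The semimodule structure given by a homomorphism to the endomorphism hemiring. -/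
@[reducible]
def ofEnd (φ : R →ₙ+* AddMonoid.End M) : LeftSemimodule R M where
  smul r m := φ r m
  mul_smul r s m := by
    change φ (r * s) m = φ r (φ s m)
    rw [map_mul]; rfl
  smul_add r m n := map_add (φ r) m n
  add_smul r s m := by
    change φ (r + s) m = φ r m + φ s m
    rw [map_add]; rfl
  smul_zero r := map_zero (φ r)
  zero_smul m := by
    change φ 0 m = 0
    rw [map_zero]; rfl

end LeftSemimodule

namespace IsSimpleLeftSemimodule

variable {R M : Type*} [NonUnitalSemiring R] [AddCommMonoid M] [LeftSemimodule R M]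

/-- The elements killed by all of `R` form a subsemimodule, which is proper because `RM ≠ 0`. -/
theorem eq_zero_of_forall_smul_eq_zero (h : IsSimpleLeftSemimodule R M) {m : M}
    (hm : ∀ r : R, r • m = 0) : m = 0 := by
  let N : AddSubmonoid M :=
    { carrier := {m | ∀ r : R, r • m = 0}
      zero_mem' := LeftSemimodule.smul_zero
      add_mem' := fun {a b} ha hb r => by
        rw [LeftSemimodule.smul_add, ha r, hb r, add_zero] }
  have hN : ∀ r : R, ∀ n ∈ N, r • n ∈ N := fun r n hn s => by
    rw [hn r, LeftSemimodule.smul_zero]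
  rcases h.subsemimodule_trivial N hN with hbot | htop
  · have : m ∈ N := hm
    rwa [hbot, AddSubmonoid.mem_bot] at this
  · obtain ⟨r, n, hrn⟩ := h.exists_smul_ne_zero
    have : n ∈ N := htop ▸ AddSubmonoid.mem_top n
    exact absurd (this r) hrn

theorem exists_smul_eq (h : IsSimpleLeftSemimodule R M) {x : M} (hx : x ≠ 0) (y : M) :
    ∃ r : R, r • x = y := by
  let N : AddSubmonoid M :=
    { carrier := {y | ∃ r : R, r • x = y}
      zero_mem' := ⟨0, LeftSemimodule.zero_smul x⟩
      add_mem' := by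
        rintro _ _ ⟨r, rfl⟩ ⟨s, rfl⟩
        exact ⟨r + s, LeftSemimodule.add_smul r s x⟩ }
  have hN : ∀ r : R, ∀ n ∈ N, r • n ∈ N := by
    rintro r _ ⟨s, rfl⟩
    exact ⟨r * s, LeftSemimodule.mul_smul r s x⟩
  rcases h.subsemimodule_trivial N hN with hbot | htop
  · refine absurd (h.eq_zero_of_forall_smul_eq_zero fun r => ?_) hx
    have : r • x ∈ N := ⟨r, rfl⟩
    rwa [hbot, AddSubmonoid.mem_bot] at this
  · exact (htop ▸ AddSubmonoid.mem_top y : y ∈ N)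

theorem exists_ne_zero (h : IsSimpleLeftSemimodule R M) : ∃ x : M, x ≠ 0 :=
  let ⟨r, m, hrm⟩ := h.exists_smul_ne_zero
  ⟨r • m, hrm⟩

theorem finite [Finite R] (h : IsSimpleLeftSemimodule R M) : Finite M := by
  obtain ⟨x, hx⟩ := h.exists_ne_zero
  exact Finite.of_surjective (fun r : R => r • x) (h.exists_smul_eq hx)

theorem add_self (h : IsSimpleLeftSemimodule R M) (hR : ∀ r : R, r + r = r) (m : M) :
    m + m = m := by
  obtain ⟨x, hx⟩ := h.exists_ne_zero
  obtain ⟨r, rfl⟩ := h.exists_smul_eq hx m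
  rw [← LeftSemimodule.add_smul, hR]

/-- Elements of an idempotent simple semimodule are determined by their annihilators. -/
theorem eq_of_forall_smul_eq_zero_iff (h : IsSimpleLeftSemimodule R M)
    (hM : ∀ m : M, m + m = m) {x y : M} (hxy : ∀ r : R, r • x = 0 ↔ r • y = 0) : x = y := by
  have add_eq_zero : ∀ a b : M, a + b = 0 ↔ a = 0 ∧ b = 0 := fun a b =>
    ⟨fun hab =>
      ⟨by calc
          a = a + (a + b) := by rw [hab, add_zero]
          _ = 0 := by rw [← add_assoc, hM, hab],
        by calc
          b = (a + b) + b := by rw [hab, zero_add]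
          _ = 0 := by rw [add_assoc, hM, hab]⟩,
      fun ⟨ha, hb⟩ => by rw [ha, hb, add_zero]⟩
  -- Having equal annihilators is a congruence; additivity holds because a sum of idempotents
  -- vanishes only if both terms do. If it were universal, `R` would kill `M`.
  let c : ModuleCon R M :=
    { r := fun x y => ∀ r : R, r • x = 0 ↔ r • y = 0
      iseqv := ⟨fun _ _ => Iff.rfl, fun h r => (h r).symm, fun h k r => (h r).trans (k r)⟩
      add' := fun {w x y z} h k r => by
        rw [LeftSemimodule.smul_add, LeftSemimodule.smul_add, add_eq_zero, add_eq_zero, h r, k r]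
      smul := fun s {x y} h r => by
        rw [← LeftSemimodule.mul_smul, ← LeftSemimodule.mul_smul, h] }
  rcases h.congruence_trivial c with hdiag | huniv
  · exact hdiag x y hxy
  · obtain ⟨r, m, hrm⟩ := h.exists_smul_ne_zero
    exact absurd ((huniv m 0 r).2 (LeftSemimodule.smul_zero r)) hrm

end IsSimpleLeftSemimodule

namespace SemilatticeWithZero

variable {M : Type*} [SemilatticeWithZero M]

theorem below_antisymm {x y : M} (hxy : Below x y) (hyx : Below y x) : x = y := by
  rw [← hyx, add_comm]; exact hxy

theorem e_apply_of_below {a x : M} (b : M) (h : Below x a) : e a b x = 0 := if_pos h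

theorem e_apply_of_not_below {a x : M} (b : M) (h : ¬ Below x a) : e a b x = b := if_neg h

theorem not_below_zero {x : M} (hx : x ≠ 0) : ¬ Below x 0 := fun h =>
  hx ((add_zero x).symm.trans h)

theorem e_mem_F (a b : M) : e a b ∈ F M := AddSubmonoid.subset_closure ⟨a, b, rfl⟩

theorem isDenseSubhemiring_of_e_mem {D : NonUnitalSubsemiring (AddMonoid.End M)}
    (h : ∀ a b, e a b ∈ D) : IsDenseSubhemiring D := fun f hf => by
  have : F M ≤ D.toAddSubmonoid := (AddSubmonoid.closure_le).2 <| by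
    rintro _ ⟨a, b, rfl⟩
    exact h a b
  exact this hf

theorem below_sum {ι : Type*} {s : Finset ι} {g : ι → M} {i : ι} (hi : i ∈ s) :
    Below (g i) (∑ j ∈ s, g j) := by
  classical
  unfold Below
  rw [← Finset.add_sum_erase s g hi, ← add_assoc, add_self]

variable {R : Type*} [NonUnitalSemiring R]

theorem map_sum_apply {ι : Type*} (φ : R →ₙ+* AddMonoid.End M) (s : Finset ι) (g : ι → R)
    (x : M) : φ (∑ i ∈ s, g i) x = ∑ i ∈ s, φ (g i) x := by
  rw [map_sum]
  exact AddMonoidHom.finsetSum_apply _ _ _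

/-- A finite hemiring acting on a semilattice transitively on nonzero elements, and such that
annihilators separate points, acts by a dense subhemiring of endomorphisms. -/
theorem isDenseSubhemiring_srange [Finite R] (φ : R →ₙ+* AddMonoid.End M)
    (htrans : ∀ x : M, x ≠ 0 → ∀ y, ∃ r, φ r x = y)
    (hsep : ∀ x y : M, (∀ r, φ r x = 0 ↔ φ r y = 0) → x = y) :
    IsDenseSubhemiring (NonUnitalRingHom.srange φ) := by
  classical
  have := Fintype.ofFinite R
  refine isDenseSubhemiring_of_e_mem fun c b => ?_
  by_cases hM : ∀ x : M, x = 0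
  · refine ⟨0, ?_⟩
    ext x
    exact (hM _).trans (hM _).symm
  push Not at hM
  obtain ⟨x₀, hx₀⟩ := hM
  -- The sum of all of `R` sends every nonzero element to the top of `M`.
  obtain ⟨t, ht⟩ : ∃ t : R, ∀ x y : M, x ≠ 0 → Below y (φ t x) := by
    refine ⟨∑ r, r, fun x y hx => ?_⟩
    obtain ⟨r, rfl⟩ := htrans x hx y
    rw [map_sum_apply]
    exact below_sum (g := fun r => φ r x) (Finset.mem_univ r)
  -- Take the sum of the annihilator of `c`. If it kills `x`, so does each summand; then `x + c` and
  -- `c` have the same annihilator, hence coincide.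
  obtain ⟨k, hk⟩ : ∃ k : R, ∀ x : M, φ k x = 0 ↔ Below x c := by
    refine ⟨∑ r with φ r c = 0, r, fun x => ?_⟩
    rw [map_sum_apply]
    constructor
    · intro h
      have hr : ∀ r, φ r c = 0 → φ r x = 0 := fun r hr => by
        by_contra hne
        refine not_below_zero hne ?_
        rw [← h]
        exact below_sum (g := fun r => φ r x) (by simpa using hr)
      refine hsep _ _ fun r => ?_
      rw [map_add]
      constructor
      · intro h0
        have := below_zero (M := M) 0
        rw [← h0, add_below_iff, h0] at this
        by_contra hne
        exact not_below_zero hne this.2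
      · intro h0
        rw [hr r h0, h0, add_zero]
    · intro h
      refine Finset.sum_eq_zero fun r hr => ?_
      have hr : φ r c = 0 := by simpa using hr
      have h2 : φ r (x + c) = φ r c := congrArg (φ r) h
      rwa [map_add, hr, add_zero] at h2
  have htop : φ t x₀ ≠ 0 := fun h => not_below_zero hx₀ (h ▸ ht x₀ x₀ hx₀)
  obtain ⟨s, hs⟩ := htrans _ htop b
  -- `k` kills exactly what lies below `c`, `t` lifts the rest to the top, and `s` moves the top to
  -- `b`.
  refine ⟨s * (t * k), ?_⟩
  ext x
  rw [map_mul, map_mul]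
  change φ s (φ t (φ k x)) = e c b x
  by_cases hx : Below x c
  · rw [e_apply_of_below b hx, (hk x).2 hx, map_zero, map_zero]
  · have hkx : φ k x ≠ 0 := fun h => hx ((hk x).1 h)
    rw [e_apply_of_not_below b hx, below_antisymm (ht x₀ _ hx₀) (ht _ (φ t x₀) hkx), hs]

/-- A semilattice on which a hemiring acts densely is a simple semimodule, unless it is zero. -/
theorem isSimpleLeftSemimodule_ofEnd (φ : R →ₙ+* AddMonoid.End M)
    (hφ : IsDenseSubhemiring (NonUnitalRingHom.srange φ)) {z : M} (hz : z ≠ 0) :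
    let _ := LeftSemimodule.ofEnd φ
    IsSimpleLeftSemimodule R M := by
  let _ := LeftSemimodule.ofEnd φ
  have key : ∀ a b : M, ∃ r : R, ∀ x : M, r • x = e a b x := fun a b => by
    obtain ⟨r, hr⟩ := hφ _ (e_mem_F a b)
    exact ⟨r, fun x => DFunLike.congr_fun hr x⟩
  refine ⟨?_, fun N hN => ?_, fun c => ?_⟩
  · obtain ⟨r, hr⟩ := key 0 z
    refine ⟨r, z, ?_⟩
    rwa [hr, e_apply_of_not_below z (not_below_zero hz)]
  · rw [or_iff_not_imp_left, AddSubmonoid.eq_bot_iff_forall]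
    intro hne
    push Not at hne
    obtain ⟨x, hxN, hx⟩ := hne
    refine (AddSubmonoid.eq_top_iff' N).2 fun b => ?_
    obtain ⟨r, hr⟩ := key 0 b
    rw [← e_apply_of_not_below b (not_below_zero hx), ← hr]
    exact hN r x hxN
  · rw [or_iff_not_imp_left]
    intro hne
    push Not at hne
    obtain ⟨x, y, hxy, hne⟩ := hne
    -- Applying `e y b` to a related pair sends `x` to `b` and `y` to `0`.
    have aux : ∀ x y : M, c.r x y → ¬ Below x y → ∀ b, c.r b 0 := fun x y hxy hb b => by
      obtain ⟨r, hr⟩ := key y b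
      have h := c.smul r hxy
      rw [hr, hr, e_apply_of_not_below b hb, e_apply_of_below b (add_self y)] at h
      exact h
    have h0 : ∀ b, c.r b 0 := by
      by_cases hb : Below x y
      · exact aux y x (c.iseqv.symm hxy) fun hb' => hne (below_antisymm hb hb')
      · exact aux x y hxy hb
    exact fun a b => c.iseqv.trans (h0 a) (c.iseqv.symm (h0 b))

end SemilatticeWithZero

open SemilatticeWithZero in
/-- A finite additively idempotent hemiring is `J_s`-semisimple if and only if its dense actions
on finite semilattices have no common nonzero annihilator. -/
theorem isJsSemisimple_iff_exists_dense_action {R : Type u} [NonUnitalSemiring R] [Finite R]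
    (hR : ∀ r : R, r + r = r) :
    IsJsSemisimple R ↔ ∀ r : R, r ≠ 0 → ∃ (M : Type u) (_ : SemilatticeWithZero M) (_ : Finite M)
      (φ : R →ₙ+* AddMonoid.End M),
      IsDenseSubhemiring (NonUnitalRingHom.srange φ) ∧ φ r ≠ 0 := by
  constructor
  · intro h r hr
    have hrad : r ∉ radicalJs R := fun hmem => hr (by rw [h] at hmem; exact hmem)
    simp only [radicalJs, Set.mem_ofPred_eq, not_forall] at hrad
    obtain ⟨M, _, _, hM, hann⟩ := hrad
    let inst : SemilatticeWithZero M := ⟨hM.add_self hR⟩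
    refine ⟨M, inst, hM.finite, LeftSemimodule.toEnd R M, ?_, fun h0 => hann fun m => ?_⟩
    · exact isDenseSubhemiring_srange _ (fun x hx y => hM.exists_smul_eq hx y)
        fun x y hxy => hM.eq_of_forall_smul_eq_zero_iff (hM.add_self hR) hxy
    · exact DFunLike.congr_fun h0 m
  · intro h
    refine Set.eq_singleton_iff_unique_mem.2 ⟨fun M _ _ _ m => LeftSemimodule.zero_smul m, ?_⟩
    intro r hr
    by_contra hne
    obtain ⟨M, _, _, φ, hφ, hφr⟩ := h r hne
    refine hφr (AddMonoidHom.ext fun m => ?_)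
    change φ r m = 0
    by_contra hm
    let _ := LeftSemimodule.ofEnd φ
    -- `φ r m ≠ 0` is the nonzero element needed for simplicity.
    exact hm (hr M (isSimpleLeftSemimodule_ofEnd φ hφ hm) m)

open SemilatticeWithZero in
theorem theorem3p11 {R : Type u} [NonUnitalSemiring R] [Finite R] (hR : ∀ r : R, r + r = r) :
    IsJsSemisimple R ↔
      ∃ (I : Type u) (S : I → Type u) (_ : ∀ i, NonUnitalSemiring (S i))
        (T : NonUnitalSubsemiring (∀ i, S i)) (f : R →ₙ+* T),
        IsSubdirectProduct T ∧ IsSemiisomorphism f ∧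
        ∀ i, ∃ (M : Type u) (_ : SemilatticeWithZero M) (_ : Finite M)
          (D : NonUnitalSubsemiring (AddMonoid.End M)),
          SemilatticeWithZero.IsDenseSubhemiring D ∧ Nonempty (S i ≃+* D) := by
  rw [isJsSemisimple_iff_exists_dense_action hR]
  constructor
  · intro h
    -- One factor per nonzero `r`, chosen so that `r` survives in it; this controls the kernel only,
    -- not injectivity.
    choose M inst hfin φ hdense hφ using fun i : {r : R // r ≠ 0} => h i.1 i.2
    let g : R →ₙ+* ∀ i, NonUnitalRingHom.srange (φ i) :=
      NonUnitalRingHom.pi fun i => NonUnitalRingHom.srangeRestrict (φ i)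
    refine ⟨{r : R // r ≠ 0}, fun i => NonUnitalRingHom.srange (φ i), inferInstance,
      NonUnitalRingHom.srange g, NonUnitalRingHom.srangeRestrict g, ?_, ⟨?_, ?_⟩, fun i =>
      ⟨M i, inst i, hfin i, NonUnitalRingHom.srange (φ i), hdense i, ⟨RingEquiv.refl _⟩⟩⟩
    · rintro i ⟨_, r, rfl⟩
      exact ⟨⟨g r, r, rfl⟩, rfl⟩
    · exact NonUnitalRingHom.srangeRestrict_surjective g
    · intro r hr
      by_contra hne
      have h1 : g r = 0 := congrArg Subtype.val hr
      exact hφ ⟨r, hne⟩ (congrArg Subtype.val (congrFun h1 ⟨r, hne⟩))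
  · rintro ⟨I, S, _, T, f, hT, ⟨hf, hker⟩, hS⟩ r hr
    have hfr : (f r : ∀ i, S i) ≠ 0 := fun h => hr (hker r (Subtype.ext h))
    obtain ⟨i, hi⟩ := Function.ne_iff.1 hfr
    obtain ⟨M, _, _, D, hD, ⟨ψ⟩⟩ := hS i
    let p : T →ₙ+* S i := (Pi.evalNonUnitalRingHom S i).comp (NonUnitalSubsemiringClass.subtype T)
    let φ : R →ₙ+* AddMonoid.End M :=
      (NonUnitalSubsemiringClass.subtype D).comp
        ((ψ : S i →ₙ+* D).comp (p.comp f))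
    refine ⟨M, _, ‹_›, φ, fun d hd => ?_, fun h => hi ?_⟩
    -- Subdirectness makes `R` act through all of `D`, so density passes to the range of `φ`.
    · obtain ⟨t, ht⟩ := hT i (ψ.symm ⟨d, hD d hd⟩)
      obtain ⟨s, rfl⟩ := hf t
      refine ⟨s, ?_⟩
      change ((ψ ((f s : ∀ i, S i) i) : D) : AddMonoid.End M) = d
      rw [show (f s : ∀ i, S i) i = _ from ht, ψ.apply_symm_apply]
    · have h1 : ψ ((f r : ∀ i, S i) i) = 0 := Subtype.ext h
      exact (map_eq_zero_iff ψ ψ.injective).1 h1
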